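/- **Random features for the symmetric Laplace kernel.** Let $D \ge 1$ and $\lambda \in [0,\infty)$. *Mondrian process.* For a box $\Theta=\prod_{d}[a_d,b_d]\subset\mathbb R^D$ with linear dimension $\mathrm{LD}(\Theta)=\sum_d (b_d-a_d)>0$, run the following recursive procedure, started on $\Theta$ at time $t_0=0$. On a box $\Phi=\prod_d[\alpha_d,\beta_d]$ at start time $t_0$, draw $T\sim\mathrm{Exp}(\mathrm{LD}(\Phi))$ and, independently of $T$, a dimension $d$ with probability $(\beta_d-\alpha_d)/\mathrm{LD}(\Phi)$ and, given $d$, a location $x$ uniform on $[\alpha_d,\beta_d]$. Cut $\Phi$ at time $t_0+T$ by the hyperplane $\{z_d=x\}$, and continue independently on $\{z\in\Phi: z_d\le x\}$ and $\{z\in\Phi: z_d\ge x\}$, both with start time $t_0+T$. The partition of $\Theta$ formed by the cuts made at times $\le\lambda$ (points on a cut being assigned to the lower side) is the Mondrian process on $\Theta$ with lifetime $\lambda$; its law is denoted $\mathrm{MP}(\lambda,\Theta)$. A Mondrian process on $\mathbb R^D$ with lifetime $\lambda$ is a random partition of $\mathbb R^D$ whose restriction to every box $\Theta$ with $\mathrm{LD}(\Theta)>0$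 has law $\mathrm{MP}(\lambda,\Theta)$. (Laws of random partitions are taken on the $\sigma$-algebra generated by the events that two given points lie in the same cell.) *Features.* Let $S$ be either $\mathbb R^D$ or a box of positive linear dimension, and let $\mathsf x_1,\dots,\mathsf x_N\in S$ be data points. Given a partition of $S$, let $l(\mathsf x)$ be the cell containing $\mathsf x$, let $l_1,\dots,l_C$ be the cells that contain at least one data point, and put $z(\mathsf x)=(\mathbb 1[l(\mathsf x)=l_1],\dots,\mathbb 1[l(\mathsf x)=l_C])^T\in\mathbb R^C$. For $M\ge1$ partitions with feature maps $z_1,\dots,z_M$ let $Z_M(\mathsf x)$ be $M^{-1/2}$ times the concatenation of $z_1(\mathsf x),\dots,z_M(\mathsf x)$. *Claim.* Let $\mathsf x,\mathsf x'$ be two of the data points, and $k(\mathsf x,\mathsf x')=\exp(-\lambda\|\mathsf x-\mathsf x'\|_1)=\exp\bigl(-\lambda\sum_{d=1}^D|x_d-x'_d|\bigr)$ the symmetric Laplace kernel. 1. For a Mondrian process on $S$ with lifetime $\lambda$, $z(\mathsf x)^Tz(\mathsf x')=\mathbb 1[l(\mathsf x)=l(\mathsf x')]$, and $$\mathbb P\bigl(l(\mathsf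 x)=l(\mathsf x')\bigr)=\mathbb P\bigl(z(\mathsf x)^Tz(\mathsf x')=1\bigr)=\mathbb E\bigl[z(\mathsf x)^Tz(\mathsf x')\bigr]=k(\mathsf x,\mathsf x').$$ 2. For $M\ge1$ independent Mondrian processes on $S$ with lifetime $\lambda$, $Z_M(\mathsf x)^TZ_M(\mathsf x')=\frac1M\sum_{m=1}^M z_m(\mathsf x)^Tz_m(\mathsf x')$, and this is a square-integrable unbiased estimator of the kernel: $\mathbb E[Z_M(\mathsf x)^TZ_M(\mathsf x')]=k(\mathsf x,\mathsf x')$. 3. For an infinite sequence of independent Mondrian processes on $S$ with lifetime $\lambda$, $Z_M(\mathsf x)^TZ_M(\mathsf x')\to k(\mathsf x,\mathsf x')$ almost surely as $M\to\infty$, and the standard deviation of $Z_M(\mathsf x)^TZ_M(\mathsf x')$ is $O(M^{-1/2})$. -/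

import Mathlib

open MeasureTheory ProbabilityTheory Filter Asymptotics
open scoped ENNReal NNReal Topology unitInterval

noncomputable section

namespace Mondrian

/-! ### Boxes -/

/-- An axis-aligned box `[lo 1, hi 1] × ⋯ × [lo D, hi D]` in `ℝ^D`. -/
structure Box (D : ℕ) where
  lo : Fin D → ℝ
  hi : Fin D → ℝ
  lo_le_hi : ∀ d, lo d ≤ hi d

namespace Box

variable {D : ℕ}

/-- The points of the box. -/
def toSet (Θ : Box D) : Set (Fin D → ℝ) := {z | ∀ d, Θ.lo d ≤ z d ∧ z d ≤ Θ.hi d}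

/-- The side length in dimension `d`. -/
def side (Θ : Box D) (d : Fin D) : ℝ := Θ.hi d - Θ.lo d

/-- The linear dimension: the sum of the side lengths. -/
def linearDim (Θ : Box D) : ℝ := ∑ d, Θ.side d

end Box

/-! ### Sampling one cut

The randomness used at a node of the tree is a triple `(e, u, v)` of independent variables, `e`
standard exponential, `u` and `v` uniform on `[0, 1]`.  From it the waiting time, the dimension and
the location of the cut are obtained by inverse transform sampling; `map_sampleCut` below checks
that they have the prescribed joint law. -/

abbrev Seed : Type := ℝ × I × I

def seedMeasure : Measure Seed :=
  (expMeasure 1).prod ((volume : Measure I).prod (volume : Measure I))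

instance : IsProbabilityMeasure (expMeasure 1) := isProbabilityMeasure_expMeasure one_pos

instance : IsProbabilityMeasure seedMeasure := by
  unfold seedMeasure; infer_instance

namespace Box

variable {D : ℕ}

/-- The waiting time until the first cut, `Exp(1) / LD(Θ)`, which is an `Exp(LD(Θ))` variable.  If
the linear dimension is `0` it is (almost surely) `∞`. -/
def waitingTime (Θ : Box D) (s : Seed) : ℝ≥0∞ :=
  ENNReal.ofReal s.1 / ENNReal.ofReal Θ.linearDim

/-- The dimension of the cut: the first `d` such that the sum of the side lengths in the dimensions
up to and including `d` exceeds the fraction `u` of the linear dimension. -/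
def cutDim [NeZero D] (Θ : Box D) (s : Seed) : Fin D :=
  if h : (Finset.univ.filter
      fun d => (s.2.1 : ℝ) * Θ.linearDim < ∑ i ∈ Finset.Iic d, Θ.side i).Nonempty
  then Finset.min' _ h else 0

/-- The point of `[lo d, hi d]` that divides this interval in the ratio `v : 1 - v`. -/
def pointAt (Θ : Box D) (d : Fin D) (v : I) : ℝ := Θ.lo d + (v : ℝ) * Θ.side d

/-- The location of the cut, uniform on the side in the dimension of the cut. -/
def cutLoc [NeZero D] (Θ : Box D) (s : Seed) : ℝ := Θ.pointAt (Θ.cutDim s) s.2.2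

theorem lo_le_pointAt (Θ : Box D) (d : Fin D) (v : I) : Θ.lo d ≤ Θ.pointAt d v := by
  have h1 := Θ.lo_le_hi d
  have h2 := v.2.1
  unfold pointAt side
  nlinarith

theorem pointAt_le_hi (Θ : Box D) (d : Fin D) (v : I) : Θ.pointAt d v ≤ Θ.hi d := by
  have h1 := Θ.lo_le_hi d
  have h2 := v.2.2
  unfold pointAt side
  nlinarith

/-- The box `{z ∈ Θ | z_d ≤ x}` (for `upper = false`) or `{z ∈ Θ | z_d ≥ x}` (for `upper = true`),
where `d` is the dimension and `x` the location of the sampled cut. -/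
def child [NeZero D] (Θ : Box D) (s : Seed) (upper : Bool) : Box D :=
  if upper then
    { lo := Function.update Θ.lo (Θ.cutDim s) (Θ.cutLoc s)
      hi := Θ.hi
      lo_le_hi := fun i => by
        rcases eq_or_ne i (Θ.cutDim s) with rfl | h
        · simpa [cutLoc] using Θ.pointAt_le_hi _ _
        · simpa [h] using Θ.lo_le_hi i }
  else
    { lo := Θ.lo
      hi := Function.update Θ.hi (Θ.cutDim s) (Θ.cutLoc s)
      lo_le_hi := fun i => by
        rcases eq_or_ne i (Θ.cutDim s) with rfl | h
        · simpa [cutLoc] using Θ.lo_le_pointAt _ _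
        · simpa [h] using Θ.lo_le_hi i }

/-! The law of the sampled cut. -/

theorem side_nonneg (Θ : Box D) (d : Fin D) : 0 ≤ Θ.side d := sub_nonneg.2 (Θ.lo_le_hi d)

theorem linearDim_nonneg (Θ : Box D) : 0 ≤ Θ.linearDim :=
  Finset.sum_nonneg fun d _ => Θ.side_nonneg d

theorem sum_Iic_side (Θ : Box D) (d : Fin D) :
    ∑ i ∈ Finset.Iic d, Θ.side i = ∑ i ∈ Finset.Iio d, Θ.side i + Θ.side d := by
  rw [← Finset.Iio_insert, Finset.sum_insert (by simp), add_comm]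

theorem cutDim_eq_iff [NeZero D] (Θ : Box D) (hΘ : 0 < Θ.linearDim) (s : Seed) (hs : s.2.1 < 1)
    (d : Fin D) : Θ.cutDim s = d ↔
      ∑ i ∈ Finset.Iio d, Θ.side i ≤ (s.2.1 : ℝ) * Θ.linearDim ∧
        (s.2.1 : ℝ) * Θ.linearDim < ∑ i ∈ Finset.Iic d, Θ.side i := by
  have hs' : (s.2.1 : ℝ) < 1 := by exact_mod_cast hs
  have hmono : ∀ a b : Fin D, a < b → ∑ i ∈ Finset.Iic a, Θ.side i ≤ ∑ i ∈ Finset.Iio b, Θ.side i :=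
    fun a b hab => Finset.sum_le_sum_of_subset_of_nonneg
      (fun i hi => Finset.mem_Iio.2 ((Finset.mem_Iic.1 hi).trans_lt hab))
      fun i _ _ => Θ.side_nonneg i
  have hne : (Finset.univ.filter
      fun d => (s.2.1 : ℝ) * Θ.linearDim < ∑ i ∈ Finset.Iic d, Θ.side i).Nonempty := by
    refine ⟨⊤, ?_⟩
    have : Finset.Iic (⊤ : Fin D) = Finset.univ := by ext; simp
    simp only [Finset.mem_filter, Finset.mem_univ, true_and, this]
    change _ < Θ.linearDim
    nlinarith
  rw [cutDim, dif_pos hne]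
  have hmem := Finset.min'_mem _ hne
  have hmin : ∀ k, k ∈ _ → Finset.min' _ hne ≤ k := fun k hk => Finset.min'_le _ k hk
  generalize Finset.min' _ hne = m at hmem hmin
  simp only [Finset.mem_filter, Finset.mem_univ, true_and] at hmem hmin
  constructor
  · rintro rfl
    refine ⟨?_, hmem⟩
    by_contra! hlt
    rcases Nat.eq_zero_or_pos (m : ℕ) with h0 | h0
    · have : Finset.Iio m = ∅ := by
        ext i; simp [Fin.le_def, h0]
      rw [this, Finset.sum_empty] at hlt
      have := mul_nonneg s.2.1.2.1 hΘ.le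
      linarith
    · let k : Fin D := ⟨m - 1, by omega⟩
      have hk : Finset.Iic k = Finset.Iio m := by
        ext i
        rw [Finset.mem_Iic, Finset.mem_Iio, Fin.le_def, Fin.lt_def]
        change (i : ℕ) ≤ m - 1 ↔ _
        omega
      have := Fin.le_def.1 (hmin k (by rwa [hk]))
      change (m : ℕ) ≤ m - 1 at this
      omega
  · rintro ⟨h1, h2⟩
    refine le_antisymm (hmin d h2) ?_
    by_contra! hlt
    exact absurd (hmono m d hlt) (by linarith)

theorem measurable_cutDim [NeZero D] (Θ : Box D) : Measurable Θ.cutDim := by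
  classical
  have h1 : Measurable fun (s : Seed) (d : Fin D) =>
      (s.2.1 : ℝ) * Θ.linearDim < ∑ i ∈ Finset.Iic d, Θ.side i := by
    refine measurable_pi_lambda _ fun d => measurableSet_setOfPred.1 ?_
    exact measurableSet_lt (by fun_prop) measurable_const
  have h2 : Measurable fun p : Fin D → Prop =>
      if h : (Finset.univ.filter p).Nonempty then Finset.min' _ h else 0 :=
    measurable_of_finite _
  convert h2.comp h1 using 1
  ext s
  unfold cutDim
  simp only [Function.comp]

theorem map_volume_pointAt (Θ : Box D) (d : Fin D) (h : 0 < Θ.side d) :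
    (volume : Measure I).map (Θ.pointAt d) = volume[|Set.Icc (Θ.lo d) (Θ.hi d)] := by
  have hmap : (volume : Measure ℝ).map (fun v => Θ.lo d + v * Θ.side d) =
      ENNReal.ofReal (Θ.side d)⁻¹ • volume := by
    have := Real.map_volume_mul_right h.ne'
    rw [show (fun v : ℝ => Θ.lo d + v * Θ.side d) = (fun y => Θ.lo d + y) ∘ (fun v => v * Θ.side d)
      from rfl, ← Measure.map_map (by fun_prop) (by fun_prop), this, Measure.map_smul,
      MeasureTheory.map_add_left_eq_self, abs_of_pos (inv_pos.2 h)]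
  have hpre : (fun v => Θ.lo d + v * Θ.side d) ⁻¹' Set.Icc (Θ.lo d) (Θ.hi d) = I := by
    ext v
    simp only [Set.mem_preimage, Set.mem_Icc, unitInterval]
    have : Θ.hi d = Θ.lo d + 1 * Θ.side d := by unfold side; ring
    rw [this, add_le_add_iff_left, mul_le_mul_iff_left₀ h, le_add_iff_nonneg_right,
      mul_nonneg_iff_of_pos_right h]
  rw [show Θ.pointAt d = (fun v : ℝ => Θ.lo d + v * Θ.side d) ∘ ((↑) : I → ℝ) from rfl,
    ← Measure.map_map (by fun_prop) (by fun_prop), unitInterval.measurePreserving_coe.map_eq,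
    ← hpre, ← Measure.restrict_map (by fun_prop) measurableSet_Icc, hmap, ProbabilityTheory.cond,
    Real.volume_Icc, Measure.restrict_smul, ENNReal.ofReal_inv_of_pos h]
  rfl

theorem map_expMeasure_div (L : ℝ) (hL : 0 < L) :
    (expMeasure 1).map (fun e => e / L) = expMeasure L := by
  have := isProbabilityMeasure_expMeasure hL
  have := Measure.isProbabilityMeasure_map (μ := expMeasure 1)
    (f := fun e : ℝ => e / L) (by fun_prop)
  refine Measure.eq_of_cdf _ _ ?_
  ext x
  rw [cdf_expMeasure_eq hL, cdf_eq_real, map_measureReal_apply (by fun_prop) measurableSet_Iic]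
  have : (fun e : ℝ => e / L) ⁻¹' Set.Iic x = Set.Iic (x * L) := by
    ext e; simp [div_le_iff₀ hL]
  rw [this, ← cdf_eq_real, cdf_expMeasure_eq one_pos]
  simp [mul_comm x L, mul_nonneg_iff_of_pos_left hL]

/-- The joint law of waiting time, dimension and location of the first cut of a box of positive
linear dimension: the waiting time has law `Exp(LD(Θ))` and is independent of the cut, the dimension
is `d` with probability proportional to the side length in dimension `d`, and given `d` the location
is uniform on `[lo d, hi d]`. -/
def cutLaw (Θ : Box D) : Measure (ℝ≥0∞ × Fin D × ℝ) :=
  ((expMeasure Θ.linearDim).map ENNReal.ofReal).prod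
    (∑ d, ENNReal.ofReal (Θ.side d / Θ.linearDim) •
      (Measure.dirac d).prod (volume[|Set.Icc (Θ.lo d) (Θ.hi d)]))

theorem volume_cutDim_eq [NeZero D] (Θ : Box D) (hΘ : 0 < Θ.linearDim) (d : Fin D) :
    (volume : Measure I) {u | Θ.cutDim (0, u, 0) = d} =
      ENNReal.ofReal (Θ.side d / Θ.linearDim) := by
  set a := (∑ i ∈ Finset.Iio d, Θ.side i) / Θ.linearDim with ha
  set b := (∑ i ∈ Finset.Iic d, Θ.side i) / Θ.linearDim with hb
  have ha0 : 0 ≤ a := div_nonneg (Finset.sum_nonneg fun i _ => Θ.side_nonneg i) hΘ.le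
  have hb1 : b ≤ 1 := (div_le_one hΘ).2
    (Finset.sum_le_sum_of_subset_of_nonneg (Finset.subset_univ _) fun i _ _ => Θ.side_nonneg i)
  have hae : {u : I | Θ.cutDim (0, u, 0) = d} =ᵐ[volume] ((↑) : I → ℝ) ⁻¹' Set.Ico a b := by
    have h1 : ∀ᵐ u : I, u ≠ 1 := by simp [ae_iff]
    filter_upwards [h1] with u hu
    have hu' : u < 1 := lt_of_le_of_ne u.2.2 hu
    refine propext ?_
    change Θ.cutDim (0, u, 0) = d ↔ a ≤ (u : ℝ) ∧ (u : ℝ) < b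
    rw [Θ.cutDim_eq_iff hΘ _ hu', ha, hb, div_le_iff₀ hΘ, lt_div_iff₀ hΘ]
  rw [measure_congr hae, unitInterval.measurePreserving_coe.measure_preimage
    measurableSet_Ico.nullMeasurableSet, Measure.restrict_apply measurableSet_Ico,
    Set.inter_eq_left.2, Real.volume_Ico, ha, hb, sum_Iic_side]
  · congr 1; ring
  · exact fun u hu => ⟨ha0.trans hu.1, hu.2.le.trans hb1⟩

/-- The cut sampled on a box of positive linear dimension has the law `cutLaw`. -/
theorem map_sampleCut [NeZero D] (Θ : Box D) (hΘ : 0 < Θ.linearDim) :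
    seedMeasure.map (fun s => (Θ.waitingTime s, Θ.cutDim s, Θ.cutLoc s)) = Θ.cutLaw := by
  let g : I × I → Fin D × ℝ := fun q => (Θ.cutDim (0, q), Θ.cutLoc (0, q))
  have hdim : Measurable fun q : I × I => Θ.cutDim (0, q) :=
    Θ.measurable_cutDim.comp (by fun_prop)
  have hpt : ∀ d, Measurable (Θ.pointAt d) := fun d => by unfold pointAt; fun_prop
  have hptu : Measurable fun q : Fin D × I => Θ.pointAt q.1 q.2 :=
    measurable_from_prod_countable_right fun d => hpt d
  have hg : Measurable g := hdim.prodMk (hptu.comp (hdim.prodMk measurable_snd))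
  have hfun : (fun s : Seed => (Θ.waitingTime s, Θ.cutDim s, Θ.cutLoc s)) =
      Prod.map (fun e => ENNReal.ofReal (e / Θ.linearDim)) g := by
    ext s
    · simp [waitingTime, ENNReal.ofReal_div_of_pos hΘ]
    · rfl
    · rfl
  have hexp : (expMeasure 1).map (fun e => ENNReal.ofReal (e / Θ.linearDim)) =
      (expMeasure Θ.linearDim).map ENNReal.ofReal := by
    rw [← map_expMeasure_div _ hΘ, Measure.map_map (by fun_prop) (by fun_prop)]
    rfl
  have hset : ∀ d, MeasurableSet {u : I | Θ.cutDim (0, u, 0) = d} := fun d =>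
    measurableSet_eq_fun (Θ.measurable_cutDim.comp (by fun_prop)) measurable_const
  have hvol : (volume : Measure I) =
      ∑ d, (volume : Measure I).restrict {u | Θ.cutDim (0, u, 0) = d} := by
    rw [← Measure.sum_fintype, ← Measure.restrict_iUnion ?_ hset]
    · rw [Set.eq_univ_of_forall fun u => Set.mem_iUnion.2 ⟨Θ.cutDim (0, u, 0), rfl⟩,
        Measure.restrict_univ]
    · intro d d' hdd'
      exact Set.disjoint_left.2 fun u h1 h2 => hdd' (h1.symm.trans h2)
  have hpart : ((volume : Measure I).prod (volume : Measure I)) =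
      ∑ d, ((volume : Measure I).restrict {u | Θ.cutDim (0, u, 0) = d}).prod volume := by
    refine (congrArg (fun μ : Measure I => μ.prod volume) hvol).trans ?_
    rw [← Measure.sum_fintype, Measure.prod_sum_left, Measure.sum_fintype]
  rw [hfun, seedMeasure, ← Measure.map_prod_map _ _ (by fun_prop) hg, hexp, cutLaw]
  congr 1
  rw [hpart, Measure.map_finset_sum hg.aemeasurable]
  refine Finset.sum_congr rfl fun d _ => ?_
  have hcongr : g =ᵐ[((volume : Measure I).restrict {u | Θ.cutDim (0, u, 0) = d}).prod volume]
      Prod.map (fun _ => d) (Θ.pointAt d) := by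
    have h1 : ∀ᵐ u ∂((volume : Measure I).restrict {u | Θ.cutDim (0, u, 0) = d}),
        Θ.cutDim (0, u, 0) = d := ae_restrict_mem (hset d)
    filter_upwards [Measure.quasiMeasurePreserving_fst.ae h1] with q hq
    have hq' : Θ.cutDim (0, q) = d := hq
    exact Prod.ext hq' (by simp [g, cutLoc, hq'])
  rw [Measure.map_congr hcongr, ← Measure.map_prod_map _ _ measurable_const (hpt d),
    Measure.map_const, Measure.restrict_apply_univ, Θ.volume_cutDim_eq hΘ]
  rcases (Θ.side_nonneg d).eq_or_lt with h0 | h0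
  · simp [← h0]
  · rw [Θ.map_volume_pointAt d h0, Measure.prod_smul_left]

end Box

/-! ### The recursive generative procedure -/

/-- A node of the tree: its box, the time at which it is born, and its cell.  The cell is the box
without those faces that belong to a neighbour, so that the two children of a node have disjoint
cells whose union is the cell of the parent (points on a cut go to the lower side). -/
structure Node (D : ℕ) where
  box : Box D
  birth : ℝ≥0∞
  cell : Set (Fin D → ℝ)

/-- One of the two children of a node; it is born at the time of the cut of its parent. -/
def Node.child {D : ℕ} [NeZero D] (n : Node D) (s : Seed) (upper : Bool) : Node D where
  box := n.box.child s upper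
  birth := n.birth + n.box.waitingTime s
  cell := n.cell ∩ (if upper then {z | n.box.cutLoc s < z (n.box.cutDim s)}
    else {z | z (n.box.cutDim s) ≤ n.box.cutLoc s})

/-- The procedure started at the node `n`, as a function of the randomness `ω` used at the
individual nodes: the node of the generated tree at a given address (a list of turns, read from the
root).  After the cut of `n` the procedure is started at both children, which use disjoint parts of
the randomness. -/
def startedAt {D : ℕ} [NeZero D] : (List Bool → Seed) → Node D → List Bool → Node D
  | _, n, [] => n
  | ω, n, b :: w => startedAt (fun v => ω (b :: v)) (n.child (ω []) b) w

/-- The tree generated on the box `Θ`, started at time `0`. -/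
def tree {D : ℕ} [NeZero D] (Θ : Box D) (ω : List Bool → Seed) : List Bool → Node D :=
  startedAt ω ⟨Θ, 0, Θ.toSet⟩

/-- Independent randomness at all nodes. -/
def noise : Measure (List Bool → Seed) := Measure.infinitePi fun _ => seedMeasure

/-- The partition of `Θ` at time `lam`, as an equivalence relation: two points are in the same cell
if they belong to the same nodes among those that are born by time `lam`, that is, if no cut made
by time `lam` separates them. -/
def partitionAt {D : ℕ} [NeZero D] (lam : ℝ≥0) (Θ : Box D) (ω : List Bool → Seed) :
    Setoid Θ.toSet :=
  Setoid.ker fun p => {w : List Bool | (tree Θ ω w).birth ≤ lam ∧ (p : Fin D → ℝ) ∈ (tree Θ ω w).cell}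

/-- The σ-algebra on partitions generated by the events that two given points are in the same
cell. -/
instance instMeasurableSpaceSetoid {α : Type*} : MeasurableSpace (Setoid α) :=
  MeasurableSpace.comap (fun (r : Setoid α) (p : α × α) => r p.1 p.2) MeasurableSpace.pi

/-! The random partition is measurable. -/

theorem measurable_setoid_iff {A α : Type*} [MeasurableSpace A] {f : A → Setoid α} :
    Measurable f ↔ ∀ x y, MeasurableSet {a | f a x y} := by
  rw [measurable_comap_iff]
  constructor
  · intro h x y
    exact measurableSet_setOfPred.2 ((measurable_pi_apply (x, y)).comp h)
  · intro h
    exact measurable_pi_lambda _ fun p => measurableSet_setOfPred.1 (h p.1 p.2)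

/-- Joint measurability of the data of a random node. -/
def MeasurableNode {A : Type*} [MeasurableSpace A] {D : ℕ} (n : A → Node D) : Prop :=
  Measurable (fun a => (n a).box.lo) ∧ Measurable (fun a => (n a).box.hi) ∧
    Measurable (fun a => (n a).birth) ∧ ∀ p, MeasurableSet {a | p ∈ (n a).cell}

theorem MeasurableNode.child {A : Type*} [MeasurableSpace A] {D : ℕ} [NeZero D] {n : A → Node D}
    (hn : MeasurableNode n) {s : A → Seed} (hs : Measurable s) (b : Bool) :
    MeasurableNode fun a => (n a).child (s a) b := by
  classical
  obtain ⟨hlo, hhi, hbirth, hcell⟩ := hn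
  have hlo' : ∀ d, Measurable fun a => (n a).box.lo d := fun d => (measurable_pi_apply d).comp hlo
  have hside : ∀ d, Measurable fun a => (n a).box.side d := fun d =>
    ((measurable_pi_apply d).comp hhi).sub (hlo' d)
  have hL : Measurable fun a => (n a).box.linearDim := by
    unfold Box.linearDim; fun_prop
  have hdim : Measurable fun a => (n a).box.cutDim (s a) := by
    have h1 : Measurable fun (a : A) (d : Fin D) => ((s a).2.1 : ℝ) * (n a).box.linearDim <
        ∑ i ∈ Finset.Iic d, (n a).box.side i := by
      refine measurable_pi_lambda _ fun d => measurableSet_setOfPred.1 ?_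
      exact measurableSet_lt (by fun_prop) (by fun_prop)
    have h2 : Measurable fun p : Fin D → Prop =>
        if h : (Finset.univ.filter p).Nonempty then Finset.min' _ h else 0 :=
      measurable_of_finite _
    convert h2.comp h1 using 1
    ext a
    unfold Box.cutDim
    simp only [Function.comp]
  have hloc : Measurable fun a => (n a).box.cutLoc (s a) := by
    have : Measurable fun q : Fin D × A => (n q.2).box.pointAt q.1 (s q.2).2.2 :=
      measurable_from_prod_countable_right fun d => by
        have hd := hlo' d
        have hd' := hside d
        change Measurable fun a => (n a).box.lo d + ((s a).2.2 : ℝ) * (n a).box.side d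
        fun_prop
    exact this.comp (hdim.prodMk measurable_id)
  have hupd : ∀ f : A → Fin D → ℝ, Measurable f → Measurable fun a =>
      Function.update (f a) ((n a).box.cutDim (s a)) ((n a).box.cutLoc (s a)) := by
    intro f hf
    refine measurable_pi_lambda _ fun i => ?_
    simp only [Function.update_apply]
    exact Measurable.ite (measurableSet_eq_fun measurable_const hdim) hloc
      ((measurable_pi_apply i).comp hf)
  have hwait : Measurable fun a => (n a).box.waitingTime (s a) := by
    unfold Box.waitingTime; fun_prop
  have hcoord : ∀ p : Fin D → ℝ, Measurable fun a => p ((n a).box.cutDim (s a)) := fun p =>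
    (measurable_of_finite p).comp hdim
  cases b
  · refine ⟨hlo, hupd _ hhi, hbirth.add hwait, fun p => (hcell p).inter ?_⟩
    exact measurableSet_le (hcoord p) hloc
  · refine ⟨hupd _ hlo, hhi, hbirth.add hwait, fun p => (hcell p).inter ?_⟩
    exact measurableSet_lt hloc (hcoord p)

theorem measurableNode_startedAt {D : ℕ} [NeZero D] (w : List Bool) :
    ∀ {A : Type} [MeasurableSpace A] {n : A → Node D} {ω : A → List Bool → Seed},
      MeasurableNode n → Measurable ω → MeasurableNode fun a => startedAt (ω a) (n a) w := by
  induction w with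
  | nil => intro A _ n ω hn _; exact hn
  | cons b w ih =>
    intro A _ n ω hn hω
    exact ih (hn.child ((measurable_pi_apply _).comp hω) b)
      (measurable_pi_lambda _ fun v => (measurable_pi_apply _).comp hω)

/-- The random partition of a box is a random variable, so that `mondrianLaw` is its law. -/
theorem measurable_partitionAt {D : ℕ} [NeZero D] (lam : ℝ≥0) (Θ : Box D) :
    Measurable (partitionAt lam Θ) := by
  rw [measurable_setoid_iff]
  intro x y
  have hw : ∀ w, MeasurableNode fun ω => tree Θ ω w := fun w =>
    measurableNode_startedAt w ⟨measurable_const, measurable_const, measurable_const,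
      fun p => MeasurableSet.const _⟩ measurable_id
  have : {ω | partitionAt lam Θ ω x y} = ⋂ w, {ω | ((tree Θ ω w).birth ≤ lam ∧
      (x : Fin D → ℝ) ∈ (tree Θ ω w).cell) ↔ ((tree Θ ω w).birth ≤ lam ∧
      (y : Fin D → ℝ) ∈ (tree Θ ω w).cell)} := by
    ext ω
    rw [Set.mem_iInter]
    exact Set.ext_iff
  rw [this]
  refine MeasurableSet.iInter fun w => ?_
  have hb := measurableSet_le (hw w).2.2.1 (measurable_const (a := (lam : ℝ≥0∞)))
  exact measurableSet_setOfPred.2 ((measurableSet_setOfPred.1 (hb.inter ((hw w).2.2.2 x))).iff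
    (measurableSet_setOfPred.1 (hb.inter ((hw w).2.2.2 y))))

instance : IsProbabilityMeasure noise := by
  unfold noise; infer_instance

/-- The law `MP(lam, Θ)` of the Mondrian process on the box `Θ` with lifetime `lam`. -/
def mondrianLaw {D : ℕ} [NeZero D] (lam : ℝ≥0) (Θ : Box D) : Measure (Setoid Θ.toSet) :=
  noise.map (partitionAt lam Θ)

instance {D : ℕ} [NeZero D] (lam : ℝ≥0) (Θ : Box D) : IsProbabilityMeasure (mondrianLaw lam Θ) :=
  Measure.isProbabilityMeasure_map (measurable_partitionAt lam Θ).aemeasurable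

/-- The restriction of a partition of `ℝ^D` to a subset. -/
def restrict {D : ℕ} (T : Set (Fin D → ℝ)) (r : Setoid (Set.univ : Set (Fin D → ℝ))) : Setoid T :=
  r.comap (Set.inclusion (Set.subset_univ T))

/-- `IsMondrian P lam S R`: under `P`, the random partition `R` of `S` is a Mondrian process with
lifetime `lam`, where `S` is either a box of positive linear dimension or the whole of `ℝ^D`.  In
the latter case this means that the restriction of `R` to any box is a Mondrian process there. -/
inductive IsMondrian {D : ℕ} [NeZero D] {Ω : Type*} [MeasurableSpace Ω] (P : Measure Ω)
    (lam : ℝ≥0) : (S : Set (Fin D → ℝ)) → (Ω → Setoid S) → Prop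
  | box (Θ : Box D) (R : Ω → Setoid Θ.toSet) (hΘ : 0 < Θ.linearDim)
      (hR : HasLaw R (mondrianLaw lam Θ) P) : IsMondrian P lam Θ.toSet R
  | space (R : Ω → Setoid (Set.univ : Set (Fin D → ℝ)))
      (hR : ∀ Θ : Box D, 0 < Θ.linearDim →
        HasLaw (fun ω => restrict Θ.toSet (R ω)) (mondrianLaw lam Θ) P) :
      IsMondrian P lam Set.univ R

/-! ### The random features -/

section Features

variable {α : Type*}

/-- The cell `l(x)` of a partition into which the point `x` falls. -/
def cellOf (r : Setoid α) (x : α) : Set α := {y | r y x}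

open scoped Classical in
/-- The non-empty cells: those that contain at least one of the data points `X 1, …, X N`. -/
def occupiedCells {N : ℕ} (r : Setoid α) (X : Fin N → α) : Finset (Set α) :=
  Finset.univ.image fun n => cellOf r (X n)

/-- The number `C` of non-empty cells. -/
def numCells {N : ℕ} (r : Setoid α) (X : Fin N → α) : ℕ := (occupiedCells r X).card

/-- A labelling `l_1, …, l_C` of the non-empty cells. -/
def cellLabel {N : ℕ} (r : Setoid α) (X : Fin N → α) (c : Fin (numCells r X)) : Set α :=
  ((occupiedCells r X).equivFin.symm c : Set α)

open scoped Classical in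
/-- The feature vector `z(x) ∈ ℝ^C`, the indicator vector of the cell of `x`. -/
def feature {N : ℕ} (r : Setoid α) (X : Fin N → α) (x : α) : Fin (numCells r X) → ℝ :=
  fun c => if cellOf r x = cellLabel r X c then 1 else 0

/-- The concatenation of the feature vectors obtained from `M` partitions, normalised by
`M^{-1/2}`. -/
def concatFeature {N M : ℕ} (r : Fin M → Setoid α) (X : Fin N → α) (x : α) :
    (Σ m : Fin M, Fin (numCells (r m) X)) → ℝ :=
  fun c => feature (r c.1) X x c.2 / √(M : ℝ)

end Features

/-- The symmetric Laplace kernel `exp(-lam ‖x - x'‖₁)`. -/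
def laplaceKernel {D : ℕ} (lam : ℝ) (x x' : Fin D → ℝ) : ℝ :=
  Real.exp (-lam * ∑ d, |x d - x' d|)

end Mondrian

end

/-!
The heart of the matter is that the Mondrian process on a box `Θ` leaves two points `x, y ∈ Θ`
unseparated with probability `exp (-lam * ‖x - y‖₁)`.

For a node of the generated tree whose box contains both points, let `p` be the probability that the
procedure started there never separates them, and let `q` be the Laplace kernel with the remaining
lifetime `τ`.  The seed at the root and the noises on the two subtrees are independent and the
latter are again distributed like the whole noise (`map_graft`), so `p` is the expectation of its
value after the first cut (`noise_real_together`): this value is `1` if the cut comes after `τ`, it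
is `0` if the cut separates the points, and otherwise it is `p` at the child containing both.

The kernel `q` satisfies the same equation (`integral_valueAtCut`).  Indeed, if `L` is the linear
dimension of the box, the waiting time is `Exp(L)` distributed, and independently of it the cut
separates the points with probability `δ / L`, where `δ = ‖x - y‖₁`
(`Box.hyperplaneLaw_separating`); hence the assertion is the identity
`exp (-L τ) + (1 - δ / L) ∫₀^τ L exp (-L t) exp (-(τ - t) δ) dt = exp (-τ δ)`.

The equation has only one bounded solution: linear dimension and remaining lifetime only decrease
along the tree, so the first cut is in time with probability at most `r = 1 - exp (-L lam) < 1`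
with `L` the linear dimension of `Θ`, and so every use of the equation improves a uniform bound on
`|p - q|` by the factor `r` (`abs_noise_real_together_sub_le`).

For the process on the whole space the two points are put into a common box.  The inner product of
two feature vectors is the indicator of a common cell (`feature_dotProduct_feature`), and the claims
on averages are the strong law of large numbers and the additivity of the variance for independent
indicators, which are identically distributed because they have the same mean.
-/

namespace Mondrian

/-! ### Self-similarity of the noise -/

/-- The noise on the whole tree, assembled from the seed at the root and the noise on the subtrees
below the lower and the upper child. -/
def graft (p : Seed × (List Bool → Seed) × (List Bool → Seed)) : List Bool → Seed
  | [] => p.1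
  | false :: w => p.2.1 w
  | true :: w => p.2.2 w

theorem measurable_graft : Measurable graft := by
  refine measurable_pi_lambda _ fun w => ?_
  match w with
  | [] => exact measurable_fst
  | false :: w => exact (measurable_pi_apply w).comp (measurable_fst.comp measurable_snd)
  | true :: w => exact (measurable_pi_apply w).comp (measurable_snd.comp measurable_snd)

/-- The seed at the root and the noises on the two subtrees are independent, and the latter are
distributed like the noise on the whole tree. -/
theorem map_graft : (seedMeasure.prod (noise.prod noise)).map graft = noise := by
  classical
  refine Measure.eq_infinitePi _ fun s t ht => ?_
  -- Enlarge `s` to a set of addresses that splits along the root and the two subtrees.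
  let c : Bool → List Bool ↪ List Bool := fun b => ⟨List.cons b, List.cons_injective⟩
  let sub : Bool → Finset (List Bool) := fun b => s.preimage (c b) (c b).injective.injOn
  let t' : List Bool → Set Seed := fun i => if i ∈ s then t i else Set.univ
  have ht' : ∀ i, MeasurableSet (t' i) := fun i => by
    dsimp only [t']; split_ifs
    exacts [ht i, MeasurableSet.univ]
  have hpre : graft ⁻¹' Set.pi s t = t' [] ×ˢ
      (Set.pi (sub false) (fun w => t' (false :: w)) ×ˢ
        Set.pi (sub true) (fun w => t' (true :: w))) := by
    ext ⟨e, ω₀, ω₁⟩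
    simp only [Set.mem_preimage, Set.mem_pi, Set.mem_prod, Finset.mem_coe, sub, t',
      Finset.mem_preimage, c, Function.Embedding.coeFn_mk]
    constructor
    · intro h
      refine ⟨?_, fun w hw => ?_, fun w hw => ?_⟩
      · split_ifs with h0
        exacts [h [] h0, Set.mem_univ _]
      · rw [if_pos hw]; exact h _ hw
      · rw [if_pos hw]; exact h _ hw
    · rintro ⟨h0, hf, ht⟩ w hw
      match w, hw with
      | [], hw => rw [if_pos hw] at h0; exact h0
      | false :: w, hw => have := hf w hw; rw [if_pos hw] at this; exact this
      | true :: w, hw => have := ht w hw; rw [if_pos hw] at this; exact this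
  have hprod : ∏ i ∈ s, seedMeasure (t i) =
      ∏ i ∈ insert [] ((sub false).map (c false) ∪ (sub true).map (c true)),
        seedMeasure (t' i) := by
    have h1 : ∏ i ∈ s, seedMeasure (t i) = ∏ i ∈ s, seedMeasure (t' i) :=
      Finset.prod_congr rfl fun i hi => by simp only [t', if_pos hi]
    rw [h1]
    refine Finset.prod_subset (fun w hw => ?_) fun w _ hw => ?_
    · match w, hw with
      | [], _ => simp
      | false :: w, hw => simp [sub, c, hw]
      | true :: w, hw => simp [sub, c, hw]
    · simp only [t', if_neg hw, measure_univ]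
  have hpi : ∀ b, noise (Set.pi (sub b) fun w => t' (b :: w)) =
      ∏ w ∈ sub b, seedMeasure (t' (b :: w)) := fun b =>
    Measure.infinitePi_pi _ fun w _ => ht' _
  rw [Measure.map_apply measurable_graft
      (MeasurableSet.pi s.countable_toSet fun i _ => ht i), hpre,
    Measure.prod_prod, Measure.prod_prod, hpi, hpi, hprod, Finset.prod_insert (by simp [c]),
    Finset.prod_union, Finset.prod_map, Finset.prod_map]
  · rfl
  · rw [Finset.disjoint_left]
    intro w h0 h1
    simp only [Finset.mem_map, c, Function.Embedding.coeFn_mk] at h0 h1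
    obtain ⟨_, _, rfl⟩ := h0
    obtain ⟨_, _, h⟩ := h1
    simp at h

/-! ### The event that two points are never separated -/

section Together

variable {D : ℕ} [NeZero D]

theorem le_birth_startedAt (w : List Bool) : ∀ (ω : List Bool → Seed) (n : Node D),
    n.birth ≤ (startedAt ω n w).birth := by
  induction w with
  | nil => exact fun _ _ => le_rfl
  | cons b w ih => exact fun ω n => le_self_add.trans (ih _ (n.child (ω []) b))

theorem cell_startedAt_subset (w : List Bool) : ∀ (ω : List Bool → Seed) (n : Node D),
    (startedAt ω n w).cell ⊆ n.cell := by
  induction w with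
  | nil => exact fun _ _ => subset_rfl
  | cons b w ih => exact fun ω n => (ih _ (n.child (ω []) b)).trans Set.inter_subset_left

/-- The event that the procedure started at the node `n` makes no cut between `x` and `y` by the
time `lam`. -/
def together (lam : ℝ≥0) (x y : Fin D → ℝ) (n : Node D) : Set (List Bool → Seed) :=
  {ω | ∀ w, ((startedAt ω n w).birth ≤ lam ∧ x ∈ (startedAt ω n w).cell) ↔
    ((startedAt ω n w).birth ≤ lam ∧ y ∈ (startedAt ω n w).cell)}

variable {lam : ℝ≥0} {x y : Fin D → ℝ}

theorem partitionAt_iff {Θ : Box D} {ω : List Bool → Seed} {p q : Θ.toSet} :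
    partitionAt lam Θ ω p q ↔ ω ∈ together lam p q ⟨Θ, 0, Θ.toSet⟩ :=
  Set.ext_iff

/-- All nodes from `n` on are born too late to matter. -/
theorem together_of_lt_birth {n : Node D} (h : lam < n.birth) : together lam x y n = Set.univ :=
  Set.eq_univ_of_forall fun ω w => by
    have : ¬ (startedAt ω n w).birth ≤ lam := not_le.2 (h.trans_le (le_birth_startedAt w ω n))
    simp [this]

/-- Below a node that contains neither of the points, no cut separates them. -/
theorem together_of_notMem {n : Node D} (hx : x ∉ n.cell) (hy : y ∉ n.cell) :
    together lam x y n = Set.univ :=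
  Set.eq_univ_of_forall fun ω w => by
    have hsub := cell_startedAt_subset w ω n
    simp only [mt (@hsub x) hx, mt (@hsub y) hy]

theorem together_eq_empty {n : Node D} (hn : n.birth ≤ lam) (h : ¬(x ∈ n.cell ↔ y ∈ n.cell)) :
    together lam x y n = ∅ :=
  Set.eq_empty_of_forall_notMem fun ω hω => h <| by
    have := hω []
    simpa [startedAt, hn] using this

/-- `x` and `y` stay together if and only if they do so in both subtrees. -/
theorem preimage_graft_together {n : Node D} (hx : x ∈ n.cell) (hy : y ∈ n.cell) :
    graft ⁻¹' together lam x y n = {p | p.2 ∈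
      together lam x y (n.child p.1 false) ×ˢ together lam x y (n.child p.1 true)} := by
  ext ⟨s, ω₀, ω₁⟩
  constructor
  · exact fun h => ⟨fun w => h (false :: w), fun w => h (true :: w)⟩
  · rintro ⟨h0, h1⟩ w
    match w with
    | [] => simp [startedAt, hx, hy]
    | false :: w => exact h0 w
    | true :: w => exact h1 w

theorem measurableSet_together (n : Node D) : MeasurableSet (together lam x y n) := by
  have hw : ∀ w, MeasurableNode fun ω => startedAt ω n w := fun w =>
    measurableNode_startedAt w ⟨measurable_const, measurable_const, measurable_const,
      fun p => MeasurableSet.const _⟩ measurable_id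
  rw [together, Set.ofPred_forall]
  refine MeasurableSet.iInter fun w => ?_
  have hb := measurableSet_le (hw w).2.2.1 (measurable_const (a := (lam : ℝ≥0∞)))
  exact measurableSet_setOfPred.2 ((measurableSet_setOfPred.1 (hb.inter ((hw w).2.2.2 x))).iff
    (measurableSet_setOfPred.1 (hb.inter ((hw w).2.2.2 y))))

/-- The probability that `x` and `y` stay together, conditioned on the seed at the root. -/
theorem noise_prod_together (n : Node D) (hx : x ∈ n.cell) (hy : y ∈ n.cell) (s : Seed) :
    (noise.prod noise) (Prod.mk s ⁻¹' (graft ⁻¹' together lam x y n)) =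
      noise (together lam x y (n.child s false)) * noise (together lam x y (n.child s true)) := by
  rw [preimage_graft_together hx hy]
  exact Measure.prod_prod (μ := noise) (ν := noise) (together lam x y (n.child s false))
    (together lam x y (n.child s true))

theorem measurable_noise_together (n : Node D) (hx : x ∈ n.cell) (hy : y ∈ n.cell) :
    Measurable fun s => noise (together lam x y (n.child s false)) *
      noise (together lam x y (n.child s true)) := by
  simp_rw [← noise_prod_together n hx hy]
  exact measurable_measure_prodMk_left (measurable_graft (measurableSet_together n))

/-- The first-cut decomposition of the probability that `x` and `y` stay together. -/
theorem noise_real_together (n : Node D) (hx : x ∈ n.cell) (hy : y ∈ n.cell) :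
    noise.real (together lam x y n) = ∫ s, noise.real (together lam x y (n.child s false)) *
      noise.real (together lam x y (n.child s true)) ∂seedMeasure := by
  simp_rw [measureReal_def, ← ENNReal.toReal_mul]
  rw [integral_toReal (measurable_noise_together n hx hy).aemeasurable
    (ae_of_all _ fun s => ENNReal.mul_lt_top (measure_lt_top _ _) (measure_lt_top _ _))]
  conv_lhs => rw [← map_graft]
  rw [Measure.map_apply measurable_graft (measurableSet_together n),
    Measure.prod_apply (measurable_graft (measurableSet_together n))]
  simp_rw [noise_prod_together n hx hy]

end Together

/-! ### The first cut -/

theorem integral_expMeasure {r : ℝ} (hr : 0 < r) (f : ℝ → ℝ) :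
    ∫ e, f e ∂expMeasure r = ∫ e in Set.Ici 0, r * Real.exp (-(r * e)) * f e := by
  have h : expMeasure r = volume.withDensity fun x => ENNReal.ofReal (exponentialPDFReal r x) := rfl
  rw [h, integral_withDensity_eq_integral_toReal_smul
    (measurable_exponentialPDFReal r).ennreal_ofReal (ae_of_all _ fun x => ENNReal.ofReal_lt_top),
    ← integral_indicator measurableSet_Ici]
  congr 1
  ext e
  change (exponentialPDF r e).toReal • f e = _
  simp only [exponentialPDF_eq, smul_eq_mul, Set.indicator_apply, Set.mem_Ici]
  split_ifs with he
  · rw [ENNReal.toReal_ofReal (by positivity)]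
  · simp

/-- For `a = ‖x - y‖₁` and a box of linear dimension `r`, the expected value of the Laplace kernel
at the time of the first cut, on the event that this cut comes by time `τ` and does not separate
`x` from `y`. -/
theorem mul_integral_expMeasure {r a τ : ℝ} (hr : 0 < r) (hτ : 0 ≤ τ) :
    (1 - a / r) * ∫ e, (if e ≤ τ then Real.exp (-((τ - e) * a)) else 0) ∂expMeasure r =
      Real.exp (-(τ * a)) - Real.exp (-(r * τ)) := by
  have h1 : ∫ e, (if e ≤ τ then Real.exp (-((τ - e) * a)) else 0) ∂expMeasure r =
      ∫ e in 0..τ, r * Real.exp (-(r * e)) * Real.exp (-((τ - e) * a)) := by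
    rw [integral_expMeasure hr, intervalIntegral.integral_of_le hτ, ← integral_Icc_eq_integral_Ioc,
      ← integral_indicator measurableSet_Ici, ← integral_indicator measurableSet_Icc]
    congr 1
    ext e
    simp only [Set.indicator_apply, Set.mem_Ici, Set.mem_Icc]
    split_ifs <;> simp_all
  have h2 : ∫ e in 0..τ, (1 - a / r) * (r * Real.exp (-(r * e)) * Real.exp (-((τ - e) * a))) =
      -Real.exp (-(r * τ) - (τ - τ) * a) - -Real.exp (-(r * 0) - (τ - 0) * a) := by
    refine intervalIntegral.integral_eq_sub_of_hasDerivAt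
      (f := fun e => -Real.exp (-(r * e) - (τ - e) * a)) (fun e _ => ?_)
      (Continuous.intervalIntegrable (by fun_prop) _ _)
    have h : HasDerivAt (fun e => -(r * e) - (τ - e) * a) (a - r) e := by
      refine ((((hasDerivAt_id' e).const_mul r).fun_neg).fun_sub
        (((hasDerivAt_id' e).const_sub τ).mul_const a)).congr_deriv ?_
      ring
    refine h.exp.fun_neg.congr_deriv ?_
    rw [sub_eq_add_neg (-(r * e)), Real.exp_add]
    field_simp
    ring
  rw [h1, ← intervalIntegral.integral_const_mul, h2]
  simp
  ring

namespace Box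

variable {D : ℕ}

/-- The law of the dimension and the location of the first cut, the second marginal of `cutLaw`. -/
noncomputable def hyperplaneLaw (Θ : Box D) : Measure (Fin D × ℝ) :=
  ∑ d, ENNReal.ofReal (Θ.side d / Θ.linearDim) •
    (Measure.dirac d).prod (volume[|Set.Icc (Θ.lo d) (Θ.hi d)])

theorem cutLaw_eq_prod (Θ : Box D) :
    Θ.cutLaw = ((expMeasure Θ.linearDim).map ENNReal.ofReal).prod Θ.hyperplaneLaw := rfl

/-- The hyperplanes `{z_d = l}` that separate `x` from `y`. -/
def separating (x y : Fin D → ℝ) : Set (Fin D × ℝ) := {p | ¬(x p.1 ≤ p.2 ↔ y p.1 ≤ p.2)}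

theorem prodMk_preimage_separating (x y : Fin D → ℝ) (d : Fin D) :
    Prod.mk d ⁻¹' separating x y = Set.Ico (min (x d) (y d)) (max (x d) (y d)) := by
  ext l
  simp only [separating, Set.mem_preimage, Set.mem_ofPred_eq, Set.mem_Ico, min_le_iff, lt_max_iff]
  grind

theorem measurableSet_separating (x y : Fin D → ℝ) : MeasurableSet (separating x y) := by
  have h : ∀ z : Fin D → ℝ, Measurable fun p : Fin D × ℝ => z p.1 ≤ p.2 := fun z =>
    measurableSet_setOfPred.1
      (measurableSet_le ((measurable_of_finite z).comp measurable_fst) measurable_snd)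
  exact measurableSet_setOfPred.2 ((h x).iff (h y)).not

theorem abs_sub_le_side {Θ : Box D} {x y : Fin D → ℝ} (hx : x ∈ Θ.toSet) (hy : y ∈ Θ.toSet)
    (d : Fin D) : |x d - y d| ≤ Θ.side d := by
  have h1 := hx d
  have h2 := hy d
  unfold side
  rw [abs_le]
  constructor <;> linarith

/-- The first cut separates `x` from `y` with probability `‖x - y‖₁ / LD(Θ)`. -/
theorem hyperplaneLaw_separating {Θ : Box D} {x y : Fin D → ℝ} (hx : x ∈ Θ.toSet)
    (hy : y ∈ Θ.toSet) :
    Θ.hyperplaneLaw (separating x y) =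
      ENNReal.ofReal ((∑ d, |x d - y d|) / Θ.linearDim) := by
  have hL := Θ.linearDim_nonneg
  rw [hyperplaneLaw, Measure.finsetSum_apply, Finset.sum_div,
    ENNReal.ofReal_sum_of_nonneg fun d _ => by positivity]
  refine Finset.sum_congr rfl fun d _ => ?_
  rw [Measure.smul_apply, Measure.prod_apply (measurableSet_separating x y), lintegral_dirac,
    prodMk_preimage_separating, smul_eq_mul]
  have hd := abs_sub_le_side hx hy d
  rcases (Θ.side_nonneg d).eq_or_lt with h0 | h0
  · rw [← h0] at hd
    simp [← h0, le_antisymm hd (abs_nonneg _)]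
  · have hsub : Set.Ico (min (x d) (y d)) (max (x d) (y d)) ⊆ Set.Icc (Θ.lo d) (Θ.hi d) :=
      Set.Ico_subset_Icc_self.trans
        (Set.Icc_subset_Icc (le_min (hx d).1 (hy d).1) (max_le (hx d).2 (hy d).2))
    rw [cond_apply measurableSet_Icc, Set.inter_eq_right.2 hsub, Real.volume_Icc, Real.volume_Ico,
      max_sub_min_eq_abs', ← side, ← ENNReal.ofReal_inv_of_pos h0,
      ← ENNReal.ofReal_mul (by positivity), ← ENNReal.ofReal_mul (by positivity)]
    congr 1
    field_simp

theorem isProbabilityMeasure_hyperplaneLaw [NeZero D] {Θ : Box D} (hΘ : 0 < Θ.linearDim) :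
    IsProbabilityMeasure Θ.hyperplaneLaw := by
  constructor
  rw [hyperplaneLaw, Measure.finsetSum_apply]
  have : ∀ d, (ENNReal.ofReal (Θ.side d / Θ.linearDim) •
      (Measure.dirac d).prod (volume[|Set.Icc (Θ.lo d) (Θ.hi d)])) Set.univ =
        ENNReal.ofReal (Θ.side d / Θ.linearDim) := fun d => by
    rcases (Θ.side_nonneg d).eq_or_lt with h0 | h0
    · simp [← h0]
    · have : IsProbabilityMeasure (volume[|Set.Icc (Θ.lo d) (Θ.hi d)]) :=
        cond_isProbabilityMeasure_of_finite (by rw [Real.volume_Icc, ← side]; simpa using h0)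
          (by simp [Real.volume_Icc])
      simp
  simp_rw [this]
  rw [← ENNReal.ofReal_sum_of_nonneg fun d _ => div_nonneg (Θ.side_nonneg d) hΘ.le,
    ← Finset.sum_div, ← linearDim, div_self hΘ.ne', ENNReal.ofReal_one]

end Box

/-! ### The Laplace kernel and the first cut -/

theorem integral_map_ofReal_expMeasure {r : ℝ} {f : ℝ≥0∞ → ℝ} (hf : Measurable f) :
    ∫ t, f t ∂(expMeasure r).map ENNReal.ofReal = ∫ e, f (ENNReal.ofReal e) ∂expMeasure r :=
  integral_map (by fun_prop) hf.aestronglyMeasurable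

theorem coe_add_ofReal_le_coe_iff {b lam : ℝ≥0} (hb : b ≤ lam) (e : ℝ) :
    (b : ℝ≥0∞) + ENNReal.ofReal e ≤ lam ↔ e ≤ lam - b := by
  have hb' : (b : ℝ) ≤ lam := hb
  rw [ENNReal.ofReal, ← ENNReal.coe_add, ENNReal.coe_le_coe, ← NNReal.coe_le_coe, NNReal.coe_add,
    Real.coe_toNNReal', ← le_sub_iff_add_le', max_le_iff]
  exact and_iff_left (sub_nonneg.2 hb')

/-- The probability that the first cut of a box of linear dimension `r` comes too late. -/
theorem integral_late {r : ℝ} (hr : 0 < r) {b lam : ℝ≥0} (hb : b ≤ lam) :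
    ∫ t : ℝ≥0∞, (if b + t ≤ lam then (0 : ℝ) else 1) ∂(expMeasure r).map ENNReal.ofReal =
      Real.exp (-(r * (lam - b))) := by
  have hτ : (0 : ℝ) ≤ lam - b := sub_nonneg.2 hb
  have := isProbabilityMeasure_expMeasure hr
  rw [integral_map_ofReal_expMeasure
    (Measurable.ite (measurableSet_le (by fun_prop) measurable_const) (by fun_prop) (by fun_prop))]
  simp_rw [coe_add_ofReal_le_coe_iff hb]
  have h : (fun e : ℝ => if e ≤ lam - b then (0 : ℝ) else 1) =
      (Set.Iic ((lam : ℝ) - b))ᶜ.indicator 1 := by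
    ext e
    simp only [Set.indicator_apply, Set.mem_compl_iff, Set.mem_Iic, Pi.one_apply]
    split_ifs <;> simp_all
  rw [h, integral_indicator_one measurableSet_Iic.compl, probReal_compl_eq_one_sub
    measurableSet_Iic, ← cdf_eq_real, cdf_expMeasure_eq hr, if_pos hτ]
  ring

/-- `mul_integral_expMeasure` on the time axis of the nodes. -/
theorem mul_integral_early {r a : ℝ} (hr : 0 < r) {b lam : ℝ≥0} (hb : b ≤ lam) :
    (1 - a / r) * ∫ t : ℝ≥0∞, (if b + t ≤ lam then Real.exp (-((lam - (b + t).toReal) * a)) else 0)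
        ∂(expMeasure r).map ENNReal.ofReal =
      Real.exp (-((lam - b) * a)) - Real.exp (-(r * (lam - b))) := by
  have hτ : (0 : ℝ) ≤ lam - b := sub_nonneg.2 hb
  rw [← mul_integral_expMeasure hr hτ, integral_map_ofReal_expMeasure
    (Measurable.ite (measurableSet_le (by fun_prop) measurable_const) (by fun_prop) (by fun_prop)),
    integral_expMeasure hr, integral_expMeasure hr]
  congr 1
  refine setIntegral_congr_fun measurableSet_Ici fun e he => ?_
  have he' : (0 : ℝ) ≤ e := he
  simp only [coe_add_ofReal_le_coe_iff hb]
  rw [ENNReal.toReal_add ENNReal.coe_ne_top ENNReal.ofReal_ne_top, ENNReal.coe_toReal,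
    ENNReal.toReal_ofReal he', sub_sub]

section FirstCut

variable {D : ℕ}

open scoped Classical in
/-- The value of the Laplace kernel after the first cut `c = (waiting time, dimension, location)` of
a box born at time `b`.  If the cut is made by time `lam`, it is `0` when the cut separates `x` from
`y`, and the kernel with the remaining lifetime `lam - (b + c.1)` otherwise; if the cut comes too
late, it is `1`. -/
noncomputable def valueAtCut (lam : ℝ≥0) (x y : Fin D → ℝ) (b : ℝ≥0)
    (c : ℝ≥0∞ × Fin D × ℝ) : ℝ :=
  if b + c.1 ≤ lam then
    if c.2 ∈ Box.separating x y then 0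
    else Real.exp (-((lam - (b + c.1).toReal) * ∑ d, |x d - y d|))
  else 1

variable {lam : ℝ≥0} {x y : Fin D → ℝ} {b : ℝ≥0}

theorem measurable_valueAtCut : Measurable (valueAtCut lam x y b) := by
  refine Measurable.ite (measurableSet_le (by fun_prop) measurable_const)
    (Measurable.ite (measurable_snd (Box.measurableSet_separating x y)) (by fun_prop) ?_)
    (by fun_prop)
  fun_prop

theorem exp_early_le_one {t : ℝ≥0∞} (ht : b + t ≤ lam) :
    Real.exp (-((lam - (b + t).toReal) * ∑ d, |x d - y d|)) ≤ 1 := by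
  have h : (b + t).toReal ≤ lam := ENNReal.toReal_mono ENNReal.coe_ne_top ht
  rw [Real.exp_le_one_iff, neg_nonpos]
  exact mul_nonneg (sub_nonneg.2 h) (Finset.sum_nonneg fun d _ => abs_nonneg _)

theorem valueAtCut_mem_Icc (c : ℝ≥0∞ × Fin D × ℝ) : valueAtCut lam x y b c ∈ Set.Icc 0 1 := by
  unfold valueAtCut
  split_ifs with h1 h2
  · simp
  · exact ⟨(Real.exp_pos _).le, exp_early_le_one h1⟩
  · simp

/-- The Laplace kernel is consistent with the first cut: its value at the birth of a box is the
expectation of its value at the time of the first cut. -/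
theorem integral_valueAtCut [NeZero D] {Θ : Box D} (hΘ : 0 < Θ.linearDim) (hx : x ∈ Θ.toSet)
    (hy : y ∈ Θ.toSet) (hb : b ≤ lam) :
    ∫ c, valueAtCut lam x y b c ∂Θ.cutLaw =
      Real.exp (-((lam - b) * ∑ d, |x d - y d|)) := by
  classical
  set a := ∑ d, |x d - y d| with ha
  have ha0 : 0 ≤ a := Finset.sum_nonneg fun d _ => abs_nonneg _
  have := isProbabilityMeasure_expMeasure hΘ
  have : IsProbabilityMeasure ((expMeasure Θ.linearDim).map ENNReal.ofReal) :=
    Measure.isProbabilityMeasure_map (by fun_prop)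
  have := Box.isProbabilityMeasure_hyperplaneLaw hΘ
  let U : ℝ≥0∞ → ℝ := fun t => if b + t ≤ lam then 0 else 1
  let V : ℝ≥0∞ → ℝ := fun t => if b + t ≤ lam then Real.exp (-((lam - (b + t).toReal) * a)) else 0
  let W : Fin D × ℝ → ℝ := (Box.separating x y)ᶜ.indicator 1
  have hset : MeasurableSet {t : ℝ≥0∞ | b + t ≤ lam} :=
    measurableSet_le (by fun_prop) measurable_const
  have hU : Measurable U := Measurable.ite hset (by fun_prop) (by fun_prop)
  have hV : Measurable V := Measurable.ite hset (by fun_prop) (by fun_prop)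
  have hW : Measurable W := measurable_one.indicator (Box.measurableSet_separating x y).compl
  -- Waiting time and cutting hyperplane are independent, so each summand integrates to a product.
  have hval : valueAtCut lam x y b = fun c => U c.1 + V c.1 * W c.2 := by
    ext c
    simp only [valueAtCut, U, V, W, Set.indicator_apply, Set.mem_compl_iff, Pi.one_apply]
    split_ifs <;> simp_all
  have hUi : Integrable U ((expMeasure Θ.linearDim).map ENNReal.ofReal) :=
    Integrable.of_bound hU.aestronglyMeasurable 1 (ae_of_all _ fun t => by
      simp only [U]; split_ifs <;> simp)
  have hVi : Integrable V ((expMeasure Θ.linearDim).map ENNReal.ofReal) :=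
    Integrable.of_bound hV.aestronglyMeasurable 1 (ae_of_all _ fun t => by
      simp only [V]
      split_ifs with h
      · rw [Real.norm_of_nonneg (Real.exp_pos _).le]; exact exp_early_le_one h
      · simp)
  have hWi : Integrable W Θ.hyperplaneLaw :=
    (integrable_const 1).indicator (Box.measurableSet_separating x y).compl
  have hWint : ∫ c, W c ∂Θ.hyperplaneLaw = 1 - a / Θ.linearDim := by
    rw [integral_indicator_one (Box.measurableSet_separating x y).compl,
      probReal_compl_eq_one_sub (Box.measurableSet_separating x y), measureReal_def,
      Box.hyperplaneLaw_separating hx hy, ENNReal.toReal_ofReal (by positivity)]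
  rw [hval, Box.cutLaw_eq_prod, integral_add (hUi.comp_fst _) (hVi.mul_prod hWi),
    integral_fun_fst, integral_prod_mul, hWint, integral_late hΘ hb, mul_comm (integral _ _),
    mul_integral_early hΘ hb]
  simp

end FirstCut

namespace Box

variable {D : ℕ} [NeZero D]

theorem aemeasurable_sampleCut {Θ : Box D} (hΘ : 0 < Θ.linearDim) :
    AEMeasurable (fun s => (Θ.waitingTime s, Θ.cutDim s, Θ.cutLoc s)) seedMeasure := by
  have := isProbabilityMeasure_expMeasure hΘ
  have : IsProbabilityMeasure ((expMeasure Θ.linearDim).map ENNReal.ofReal) :=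
    Measure.isProbabilityMeasure_map (by fun_prop)
  have := isProbabilityMeasure_hyperplaneLaw hΘ
  -- The push-forward of a map that is not a.e. measurable would be `0`.
  refine AEMeasurable.of_map_ne_zero ?_
  rw [Θ.map_sampleCut hΘ, cutLaw_eq_prod]
  exact IsProbabilityMeasure.ne_zero _

omit [NeZero D] in
theorem measurable_waitingTime (Θ : Box D) : Measurable Θ.waitingTime := by
  unfold waitingTime; fun_prop

theorem map_waitingTime {Θ : Box D} (hΘ : 0 < Θ.linearDim) :
    seedMeasure.map Θ.waitingTime = (expMeasure Θ.linearDim).map ENNReal.ofReal := by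
  have := isProbabilityMeasure_expMeasure hΘ
  have := isProbabilityMeasure_hyperplaneLaw hΘ
  have h := congrArg (Measure.map Prod.fst) (Θ.map_sampleCut hΘ)
  rw [AEMeasurable.map_map_of_aemeasurable (by fun_prop) (aemeasurable_sampleCut hΘ),
    cutLaw_eq_prod, Measure.map_fst_prod, measure_univ, one_smul] at h
  exact h

theorem child_toSet {Θ : Box D} {z : Fin D → ℝ} (hz : z ∈ Θ.toSet) (s : Seed) (b : Bool)
    (h : if b then Θ.cutLoc s < z (Θ.cutDim s) else z (Θ.cutDim s) ≤ Θ.cutLoc s) :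
    z ∈ (Θ.child s b).toSet := by
  intro d
  rcases eq_or_ne d (Θ.cutDim s) with rfl | hd
  · cases b
    · simpa [child] using ⟨(hz _).1, h⟩
    · simpa [child] using ⟨le_of_lt h, (hz _).2⟩
  · cases b <;> simpa [child, hd] using hz d

theorem linearDim_child_le (Θ : Box D) (s : Seed) (b : Bool) :
    (Θ.child s b).linearDim ≤ Θ.linearDim := by
  refine Finset.sum_le_sum fun d _ => ?_
  have h1 := Θ.lo_le_pointAt (Θ.cutDim s) s.2.2
  have h2 := Θ.pointAt_le_hi (Θ.cutDim s) s.2.2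
  rcases eq_or_ne d (Θ.cutDim s) with rfl | hd
  · cases b
    · simp [child, side, cutLoc, h2]
    · simp only [child, side, cutLoc, if_true, Function.update_self]
      linarith
  · cases b <;> simp [child, side, hd]

end Box

/-! ### The probability that two points stay together -/

section Estimate

variable {D : ℕ} [NeZero D] {lam : ℝ≥0} {x y : Fin D → ℝ}

omit [NeZero D] in
theorem linearDim_pos_of_ne {Θ : Box D} (hx : x ∈ Θ.toSet) (hy : y ∈ Θ.toSet) (hxy : x ≠ y) :
    0 < Θ.linearDim := by
  obtain ⟨d, hd⟩ := Function.ne_iff.1 hxy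
  exact ((abs_pos.2 (sub_ne_zero.2 hd)).trans_le (Box.abs_sub_le_side hx hy d)).trans_le
    (Finset.single_le_sum (fun d _ => Θ.side_nonneg d) (Finset.mem_univ d))

/-- The probability that `x` and `y` stay together and the Laplace kernel satisfy the same first-cut
equation, so that the bound on their distance improves by the factor `1 - exp (-L lam)` each time
the equation is used. -/
theorem abs_noise_real_together_sub_le (hxy : x ≠ y) {L : ℝ} (k : ℕ) :
    ∀ n : Node D, x ∈ n.cell → y ∈ n.cell → x ∈ n.box.toSet → y ∈ n.box.toSet → n.birth ≤ lam →
      n.box.linearDim ≤ L →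
      |noise.real (together lam x y n) -
        Real.exp (-((lam - n.birth.toReal) * ∑ d, |x d - y d|))| ≤
          (1 - Real.exp (-(L * lam))) ^ k := by
  induction k with
  | zero =>
    intro n _ _ _ _ hn _
    have h1 : Real.exp (-((lam - n.birth.toReal) * ∑ d, |x d - y d|)) ≤ 1 := by
      simpa using exp_early_le_one (x := x) (y := y) (b := 0) ((zero_add n.birth).trans_le hn)
    have h2 := Real.exp_pos (-((lam - n.birth.toReal) * ∑ d, |x d - y d|))
    have h3 := measureReal_le_one (μ := noise) (s := together lam x y n)
    have h4 := measureReal_nonneg (μ := noise) (s := together lam x y n)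
    rw [pow_zero, abs_le]
    constructor <;> linarith
  | succ k ih =>
    intro n hx hy hxb hyb hn hL
    set r := 1 - Real.exp (-(L * lam)) with hr
    have hLD := linearDim_pos_of_ne hxb hyb hxy
    have hr0 : 0 ≤ r := sub_nonneg.2 <| Real.exp_le_one_iff.2 <|
      neg_nonpos.2 <| mul_nonneg (hLD.le.trans hL) lam.2
    obtain ⟨b, hb⟩ : ∃ b : ℝ≥0, n.birth = b :=
      ⟨_, (ENNReal.coe_toNNReal (hn.trans_lt ENNReal.coe_lt_top).ne).symm⟩
    have hbl : b ≤ lam := by rw [hb] at hn; exact_mod_cast hn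
    -- The two quantities given the first cut, and the bound `B` for their distance.
    let F : Seed → ℝ := fun s => noise.real (together lam x y (n.child s false)) *
      noise.real (together lam x y (n.child s true))
    let G : Seed → ℝ := fun s =>
      valueAtCut lam x y b (n.box.waitingTime s, n.box.cutDim s, n.box.cutLoc s)
    let B : Seed → ℝ := fun s => if b + n.box.waitingTime s ≤ lam then r ^ k else 0
    have hcut := Box.aemeasurable_sampleCut hLD
    have hG : ∫ s, G s ∂seedMeasure =
        Real.exp (-((lam - n.birth.toReal) * ∑ d, |x d - y d|)) := by
      rw [← integral_map hcut measurable_valueAtCut.aestronglyMeasurable, n.box.map_sampleCut hLD,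
        integral_valueAtCut hLD hxb hyb hbl, hb, ENNReal.coe_toReal]
    have hFi : Integrable F seedMeasure := by
      have hm : Measurable F := by
        have := (measurable_noise_together (lam := lam) n hx hy).ennreal_toReal
        simpa only [F, measureReal_def, ENNReal.toReal_mul] using this
      refine Integrable.of_bound hm.aestronglyMeasurable 1 (ae_of_all _ fun s => ?_)
      rw [Real.norm_of_nonneg (by positivity)]
      exact mul_le_one₀ measureReal_le_one measureReal_nonneg measureReal_le_one
    have hGi : Integrable G seedMeasure :=
      Integrable.of_bound (measurable_valueAtCut.comp_aemeasurable hcut).aestronglyMeasurable 1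
        (ae_of_all _ fun s => by
          have := valueAtCut_mem_Icc (lam := lam) (x := x) (y := y) (b := b)
            (n.box.waitingTime s, n.box.cutDim s, n.box.cutLoc s)
          rw [Real.norm_of_nonneg this.1]
          exact this.2)
    have hUm : Measurable fun t : ℝ≥0∞ => if (b : ℝ≥0∞) + t ≤ lam then (0 : ℝ) else 1 :=
      Measurable.ite (measurableSet_le (by fun_prop) measurable_const) (by fun_prop) (by fun_prop)
    have hUi : Integrable
        (fun s => if (b : ℝ≥0∞) + n.box.waitingTime s ≤ lam then (0 : ℝ) else 1) seedMeasure :=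
      Integrable.of_bound (hUm.comp n.box.measurable_waitingTime).aestronglyMeasurable 1
        (ae_of_all _ fun s => by split_ifs <;> simp)
    have hBeq : B = fun s =>
        r ^ k * (1 - if (b : ℝ≥0∞) + n.box.waitingTime s ≤ lam then (0 : ℝ) else 1) := by
      ext s; simp only [B]; split_ifs <;> simp
    have hBi : Integrable B seedMeasure := by
      rw [hBeq]; exact ((integrable_const 1).sub hUi).const_mul _
    -- The first cut is in time with probability at most `r`.
    have hB : ∫ s, B s ∂seedMeasure ≤ r ^ (k + 1) := by
      have hU := integral_late hLD hbl
      rw [← Box.map_waitingTime hLD, integral_map n.box.measurable_waitingTime.aemeasurable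
        hUm.aestronglyMeasurable] at hU
      rw [hBeq, integral_const_mul, integral_sub (integrable_const 1) hUi, hU, pow_succ]
      refine mul_le_mul_of_nonneg_left ?_ (pow_nonneg hr0 k)
      have : n.box.linearDim * (lam - b) ≤ L * lam :=
        mul_le_mul hL (sub_le_self _ b.2) (sub_nonneg.2 hbl) (hLD.le.trans hL)
      have := Real.exp_le_exp.2 (neg_le_neg this)
      simp only [integral_const, probReal_univ, smul_eq_mul, hr]
      linarith
    -- A late cut and a separating cut leave no difference; after any other cut the difference is
    -- the one at the child that contains both points.
    have hFG : ∀ s, ‖F s - G s‖ ≤ B s := by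
      intro s
      have hbirth : ∀ u, (n.child s u).birth = b + n.box.waitingTime s := fun u => by
        rw [← hb]; rfl
      have hlow : ∀ z ∈ n.cell, (z ∈ (n.child s false).cell ↔
          z (n.box.cutDim s) ≤ n.box.cutLoc s) := fun z hz =>
        ⟨fun h => h.2, fun h => ⟨hz, h⟩⟩
      have hupp : ∀ z ∈ n.cell, (z ∈ (n.child s true).cell ↔
          n.box.cutLoc s < z (n.box.cutDim s)) := fun z hz =>
        ⟨fun h => h.2, fun h => ⟨hz, h⟩⟩
      by_cases hT : b + n.box.waitingTime s ≤ lam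
      swap
      · simp only [F, G, B, valueAtCut, if_neg hT]
        rw [together_of_lt_birth (by rw [hbirth]; exact not_le.1 hT),
          together_of_lt_birth (by rw [hbirth]; exact not_le.1 hT)]
        simp
      by_cases hsep : (n.box.cutDim s, n.box.cutLoc s) ∈ Box.separating x y
      · simp only [F, G, B, valueAtCut, if_pos hT, if_pos hsep]
        rw [together_eq_empty ((hbirth false).trans_le hT)
          (by rw [hlow x hx, hlow y hy]; exact hsep)]
        simpa using pow_nonneg hr0 k
      simp only [F, G, B, valueAtCut, if_pos hT, if_neg hsep, Real.norm_eq_abs]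
      have hsep' : x (n.box.cutDim s) ≤ n.box.cutLoc s ↔ y (n.box.cutDim s) ≤ n.box.cutLoc s :=
        not_not.1 hsep
      have hLc := fun u => (n.box.linearDim_child_le s u).trans hL
      rcases le_or_gt (x (n.box.cutDim s)) (n.box.cutLoc s) with h | h
      · have h' := hsep'.1 h
        rw [together_of_notMem (n := n.child s true) (by rw [hupp x hx]; exact not_lt.2 h)
          (by rw [hupp y hy]; exact not_lt.2 h'), probReal_univ, mul_one, ← hbirth false]
        exact ih (n.child s false) ((hlow x hx).2 h) ((hlow y hy).2 h')
          (Box.child_toSet hxb s false h) (Box.child_toSet hyb s false h')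
          ((hbirth false).trans_le hT) (hLc false)
      · have h' : n.box.cutLoc s < y (n.box.cutDim s) := not_le.1 fun h0 => h.not_ge (hsep'.2 h0)
        rw [together_of_notMem (n := n.child s false) (by rw [hlow x hx]; exact not_le.2 h)
          (by rw [hlow y hy]; exact not_le.2 h'), probReal_univ, one_mul, ← hbirth true]
        exact ih (n.child s true) ((hupp x hx).2 h) ((hupp y hy).2 h')
          (Box.child_toSet hxb s true h) (Box.child_toSet hyb s true h')
          ((hbirth true).trans_le hT) (hLc true)
    rw [noise_real_together n hx hy, ← hG, ← integral_sub hFi hGi, ← Real.norm_eq_abs]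
    exact (norm_integral_le_of_norm_le hBi (ae_of_all _ hFG)).trans hB

/-- Two points of a box lie in the same cell of the Mondrian process on this box with the
probability given by the Laplace kernel. -/
theorem noise_partitionAt (Θ : Box D) (p q : Θ.toSet) :
    noise {ω | partitionAt lam Θ ω p q} =
      ENNReal.ofReal (laplaceKernel lam (p : Fin D → ℝ) q) := by
  rcases eq_or_ne p q with rfl | hpq
  · have : {ω | partitionAt lam Θ ω p p} = Set.univ :=
      Set.eq_univ_of_forall fun ω => (partitionAt lam Θ ω).refl p
    rw [this]
    simp [laplaceKernel]
  have hset : {ω | partitionAt lam Θ ω p q} = together lam p q ⟨Θ, 0, Θ.toSet⟩ :=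
    Set.ext fun ω => partitionAt_iff
  have hne : (p : Fin D → ℝ) ≠ q := fun h => hpq (Subtype.ext h)
  have hr1 : |1 - Real.exp (-(Θ.linearDim * lam))| < 1 := by
    have h1 := Real.exp_pos (-(Θ.linearDim * lam))
    have h2 : Real.exp (-(Θ.linearDim * lam)) ≤ 1 := Real.exp_le_one_iff.2 <|
      neg_nonpos.2 <| mul_nonneg Θ.linearDim_nonneg lam.2
    rw [abs_lt]
    constructor <;> linarith
  have h0 : |noise.real (together lam p q ⟨Θ, 0, Θ.toSet⟩) -
      Real.exp (-((lam - (0 : ℝ≥0∞).toReal) * ∑ d, |(p : Fin D → ℝ) d - (q : Fin D → ℝ) d|))| ≤ 0 :=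
    ge_of_tendsto' (tendsto_pow_atTop_nhds_zero_of_abs_lt_one hr1) fun k =>
      abs_noise_real_together_sub_le hne k ⟨Θ, 0, Θ.toSet⟩ p.2 q.2 p.2 q.2 zero_le le_rfl
  have h := sub_eq_zero.1 (abs_eq_zero.1 (le_antisymm h0 (abs_nonneg _)))
  rw [hset, ← ofReal_measureReal, h, laplaceKernel]
  simp

end Estimate

section IsMondrian

variable {D : ℕ} [NeZero D] {lam : ℝ≥0}

theorem measurableSet_setoid {α : Type*} (x y : α) : MeasurableSet {r : Setoid α | r x y} :=
  measurable_setoid_iff.1 measurable_id x y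

theorem mondrianLaw_apply (Θ : Box D) (p q : Θ.toSet) :
    mondrianLaw lam Θ {r | r p q} = ENNReal.ofReal (laplaceKernel lam (p : Fin D → ℝ) q) := by
  rw [mondrianLaw, Measure.map_apply (measurable_partitionAt lam Θ) (measurableSet_setoid p q)]
  exact noise_partitionAt Θ p q

/-- Any two points lie in a box of positive linear dimension. -/
theorem exists_box_mem (x y : Fin D → ℝ) :
    ∃ Θ : Box D, 0 < Θ.linearDim ∧ x ∈ Θ.toSet ∧ y ∈ Θ.toSet := by
  refine ⟨⟨fun d => min (x d) (y d), fun d => max (x d) (y d) + 1, fun d => ?_⟩, ?_, ?_, ?_⟩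
  · exact min_le_max.trans (by simp)
  · refine Finset.sum_pos (fun d _ => ?_) Finset.univ_nonempty
    have : min (x d) (y d) ≤ max (x d) (y d) := min_le_max
    simp only [Box.side]
    linarith
  · exact fun d => ⟨min_le_left _ _,
      (le_max_left _ (y d)).trans (le_add_of_nonneg_right zero_le_one)⟩
  · exact fun d => ⟨min_le_right _ _,
      (le_max_right (x d) _).trans (le_add_of_nonneg_right zero_le_one)⟩

variable {Ω : Type*} [MeasurableSpace Ω] {P : Measure Ω} {S : Set (Fin D → ℝ)} {R : Ω → Setoid S}

/-- Under either form of a Mondrian process, on a box or on the whole space, two points lie in the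
same cell with the probability given by the Laplace kernel. -/
theorem IsMondrian.nullMeasurableSet_and_measure (hR : IsMondrian P lam S R) (p q : S) :
    NullMeasurableSet {ω | R ω p q} P ∧
      P {ω | R ω p q} = ENNReal.ofReal (laplaceKernel lam (p : Fin D → ℝ) q) := by
  cases hR with
  | box Θ R hΘ hR =>
    exact ⟨hR.aemeasurable.nullMeasurableSet_preimage (measurableSet_setoid p q),
      (hR.measure_eq (measurableSet_setoid p q)).trans (mondrianLaw_apply Θ p q)⟩
  | space R hR =>
    obtain ⟨Θ, hΘ, hp, hq⟩ := exists_box_mem (p : Fin D → ℝ) q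
    have h := hR Θ hΘ
    have hm := measurableSet_setoid (⟨p, hp⟩ : Θ.toSet) ⟨q, hq⟩
    exact ⟨h.aemeasurable.nullMeasurableSet_preimage hm,
      (h.measure_eq hm).trans (mondrianLaw_apply Θ _ _)⟩

end IsMondrian

/-! ### The random features -/

section Features

variable {α : Type*}

theorem cellOf_eq_cellOf_iff {r : Setoid α} {x y : α} : cellOf r x = cellOf r y ↔ r x y := by
  constructor
  · intro h
    have : x ∈ cellOf r x := r.refl x
    rw [h] at this
    exact this
  · intro h
    ext z
    exact ⟨fun hz => r.trans hz h, fun hz => r.trans hz (r.symm h)⟩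

theorem exists_cellLabel_eq {N : ℕ} (r : Setoid α) (X : Fin N → α) (i : Fin N) :
    ∃ c, cellLabel r X c = cellOf r (X i) := by
  classical
  have h : cellOf r (X i) ∈ occupiedCells r X := Finset.mem_image_of_mem _ (Finset.mem_univ i)
  exact ⟨(occupiedCells r X).equivFin ⟨_, h⟩, by simp [cellLabel]⟩

theorem cellLabel_injective {N : ℕ} (r : Setoid α) (X : Fin N → α) :
    Function.Injective (cellLabel r X) :=
  Subtype.val_injective.comp (occupiedCells r X).equivFin.symm.injective

open scoped Classical in
/-- The indicator of the event that two given points lie in the same cell. -/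
noncomputable def sameCell (x y : α) (r : Setoid α) : ℝ := if r x y then 1 else 0

theorem measurable_sameCell (x y : α) : Measurable (sameCell x y) :=
  Measurable.ite (measurableSet_setoid x y) measurable_const measurable_const

theorem feature_dotProduct_feature {N : ℕ} (r : Setoid α) (X : Fin N → α) (i j : Fin N) :
    feature r X (X i) ⬝ᵥ feature r X (X j) = sameCell (X i) (X j) r := by
  classical
  obtain ⟨c, hc⟩ := exists_cellLabel_eq r X i
  rw [dotProduct, Finset.sum_eq_single c]
  · simp only [feature, hc, sameCell, if_true, one_mul, ← cellOf_eq_cellOf_iff,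
      eq_comm (a := cellOf r (X j))]
  · intro c' _ hc'
    have : cellOf r (X i) ≠ cellLabel r X c' := fun h =>
      hc' (cellLabel_injective r X (hc.trans h)).symm
    simp [feature, this]
  · simp

theorem concatFeature_dotProduct_concatFeature {N M : ℕ} (r : Fin M → Setoid α) (X : Fin N → α)
    (x y : α) :
    concatFeature r X x ⬝ᵥ concatFeature r X y =
      (1 / M : ℝ) * ∑ m, feature (r m) X x ⬝ᵥ feature (r m) X y := by
  simp only [dotProduct, concatFeature, Fintype.sum_sigma, Finset.mul_sum]
  refine Finset.sum_congr rfl fun m _ => Finset.sum_congr rfl fun c _ => ?_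
  rw [div_mul_div_comm, Real.mul_self_sqrt (Nat.cast_nonneg M)]
  ring

end Features

/-! ### Monte Carlo averages of independent Mondrian processes -/

section MonteCarlo

variable {D : ℕ} [NeZero D] {lam : ℝ≥0} {S : Set (Fin D → ℝ)} {Ω : Type*} [MeasurableSpace Ω]
  {P : Measure Ω}

/-- For null-measurable events, having the same probability makes the indicators identically
distributed. -/
theorem identDistrib_indicator_one {A B : Set Ω} [IsProbabilityMeasure P]
    (hA : NullMeasurableSet A P) (hB : NullMeasurableSet B P) (h : P A = P B) :
    IdentDistrib (A.indicator (1 : Ω → ℝ)) (B.indicator 1) P P := by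
  classical
  have hae : ∀ {C : Set Ω}, NullMeasurableSet C P → AEMeasurable (C.indicator (1 : Ω → ℝ)) P :=
    fun hC => (aemeasurable_const (b := (1 : ℝ))).indicator₀ hC
  refine ⟨hae hA, hae hB, ?_⟩
  ext s hs
  rw [Measure.map_apply_of_aemeasurable (hae hA) hs, Measure.map_apply_of_aemeasurable (hae hB) hs]
  have hc : P Aᶜ = P Bᶜ := by
    rw [prob_compl_eq_one_sub₀ hA, prob_compl_eq_one_sub₀ hB, h]
  -- The preimages of `s` depend only on which of `0` and `1` belong to `s`.
  have key : ∀ C : Set Ω, C.indicator (1 : Ω → ℝ) ⁻¹' s =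
      if (1 : ℝ) ∈ s then if (0 : ℝ) ∈ s then Set.univ else C
      else if (0 : ℝ) ∈ s then Cᶜ else ∅ := fun C => by
    ext ω
    by_cases hω : ω ∈ C <;> split_ifs <;> simp_all
  rw [key, key]
  split_ifs
  exacts [rfl, h, hc, rfl]

omit [NeZero D] [MeasurableSpace Ω] in
theorem sameCell_comp_eq_indicator (R : Ω → Setoid S) (p q : S) :
    (fun ω => sameCell p q (R ω)) = {ω | R ω p q}.indicator 1 := by
  ext ω
  by_cases h : R ω p q
  · rw [Set.indicator_of_mem (by exact h)]
    simp [sameCell, h]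
  · rw [Set.indicator_of_notMem (by exact h)]
    simp [sameCell, h]

variable {R : Ω → Setoid S}

theorem IsMondrian.aemeasurable_sameCell (hR : IsMondrian P lam S R) (p q : S) :
    AEMeasurable (fun ω => sameCell p q (R ω)) P := by
  rw [sameCell_comp_eq_indicator]
  exact (aemeasurable_const (b := (1 : ℝ))).indicator₀ (hR.nullMeasurableSet_and_measure p q).1

theorem IsMondrian.memLp_sameCell [IsProbabilityMeasure P] (hR : IsMondrian P lam S R) (p q : S) :
    MemLp (fun ω => sameCell p q (R ω)) 2 P :=
  MemLp.of_bound (hR.aemeasurable_sameCell p q).aestronglyMeasurable 1 (ae_of_all _ fun ω => by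
    unfold sameCell; split_ifs <;> simp)

theorem IsMondrian.integral_sameCell (hR : IsMondrian P lam S R) (p q : S) :
    ∫ ω, sameCell p q (R ω) ∂P = laplaceKernel lam (p : Fin D → ℝ) q := by
  obtain ⟨hm, hP⟩ := hR.nullMeasurableSet_and_measure p q
  rw [sameCell_comp_eq_indicator, integral_indicator₀ hm]
  simp only [Pi.one_apply, integral_const, smul_eq_mul, mul_one, measureReal_restrict_apply_univ]
  rw [measureReal_def, hP, ENNReal.toReal_ofReal (by exact (Real.exp_pos _).le)]

theorem IsMondrian.identDistrib_sameCell [IsProbabilityMeasure P] {R' : Ω → Setoid S}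
    (hR : IsMondrian P lam S R) (hR' : IsMondrian P lam S R') (p q : S) :
    IdentDistrib (fun ω => sameCell p q (R ω)) (fun ω => sameCell p q (R' ω)) P P := by
  obtain ⟨hm, hP⟩ := hR.nullMeasurableSet_and_measure p q
  obtain ⟨hm', hP'⟩ := hR'.nullMeasurableSet_and_measure p q
  rw [sameCell_comp_eq_indicator, sameCell_comp_eq_indicator]
  exact identDistrib_indicator_one hm hm' (hP.trans hP'.symm)

/-- The standard deviation of an average of `M` independent identically distributed square
integrable random variables is `O(M^{-1/2})`. -/
theorem isBigO_sqrt_variance_average [IsProbabilityMeasure P] {Y : ℕ → Ω → ℝ}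
    (hL2 : ∀ m, MemLp (Y m) 2 P) (hindep : Pairwise fun m n => Y m ⟂ᵢ[P] Y n)
    (hident : ∀ m, IdentDistrib (Y m) (Y 0) P P) :
    (fun M : ℕ => √(variance (fun ω => (1 / M : ℝ) * ∑ m : Fin M, Y m ω) P)) =O[atTop]
      fun M : ℕ => (M : ℝ) ^ (-(1 / 2) : ℝ) := by
  refine IsBigO.of_bound (√(variance (Y 0) P)) ?_
  filter_upwards [eventually_gt_atTop 0] with M hM
  have hM' : (0 : ℝ) < M := Nat.cast_pos.2 hM
  have hsum : (fun ω => ∑ m : Fin M, Y m ω) = ∑ m ∈ Finset.range M, Y m := by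
    ext ω
    rw [Finset.sum_apply, Finset.sum_range]
  have hvar : variance (fun ω => (1 / M : ℝ) * ∑ m : Fin M, Y m ω) P =
      variance (Y 0) P * (M : ℝ)⁻¹ := by
    rw [variance_const_mul, hsum, IndepFun.variance_sum (fun m _ => hL2 m)
      (fun m _ n _ hmn => hindep hmn), Finset.sum_congr rfl fun m _ => (hident m).variance_eq]
    simp only [Finset.sum_const, Finset.card_range, nsmul_eq_mul]
    field_simp
  rw [hvar, Real.sqrt_mul (variance_nonneg _ _), Real.norm_of_nonneg (by positivity),
    Real.norm_of_nonneg (by positivity), Real.rpow_neg hM'.le, ← Real.sqrt_eq_rpow, Real.sqrt_inv]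

end MonteCarlo

end Mondrian

open Mondrian in
theorem mainTheorem1 {D : ℕ} [NeZero D] (lam : ℝ≥0) (S : Set (Fin D → ℝ))
    {N : ℕ} (X : Fin N → S) (i j : Fin N)
    {Ω : Type*} [MeasurableSpace Ω] (P : Measure Ω) [IsProbabilityMeasure P] :
    -- one Mondrian
    (∀ R : Ω → Setoid S, IsMondrian P lam S R →
      (∀ ω, feature (R ω) X (X i) ⬝ᵥ feature (R ω) X (X j) =
        Set.indicator {ω | cellOf (R ω) (X i) = cellOf (R ω) (X j)} 1 ω) ∧
      P {ω | cellOf (R ω) (X i) = cellOf (R ω) (X j)} =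
        ENNReal.ofReal (laplaceKernel lam (X i : Fin D → ℝ) (X j)) ∧
      P {ω | feature (R ω) X (X i) ⬝ᵥ feature (R ω) X (X j) = 1} =
        ENNReal.ofReal (laplaceKernel lam (X i : Fin D → ℝ) (X j)) ∧
      ∫ ω, feature (R ω) X (X i) ⬝ᵥ feature (R ω) X (X j) ∂P =
        laplaceKernel lam (X i : Fin D → ℝ) (X j)) ∧
    -- the average over `M` independent Mondrians
    (∀ (M : ℕ) (R : Fin M → Ω → Setoid S), 0 < M → (∀ m, IsMondrian P lam S (R m)) →
      iIndepFun R P →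
      (∀ ω, concatFeature (fun m => R m ω) X (X i) ⬝ᵥ concatFeature (fun m => R m ω) X (X j) =
        (1 / M : ℝ) * ∑ m, feature (R m ω) X (X i) ⬝ᵥ feature (R m ω) X (X j)) ∧
      MemLp (fun ω => concatFeature (fun m => R m ω) X (X i) ⬝ᵥ
        concatFeature (fun m => R m ω) X (X j)) 2 P ∧
      ∫ ω, concatFeature (fun m => R m ω) X (X i) ⬝ᵥ
        concatFeature (fun m => R m ω) X (X j) ∂P = laplaceKernel lam (X i : Fin D → ℝ) (X j)) ∧
    -- the Monte Carlo limit `M → ∞`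
    (∀ R : ℕ → Ω → Setoid S, (∀ m, IsMondrian P lam S (R m)) → iIndepFun R P →
      (∀ᵐ ω ∂P, Tendsto (fun M : ℕ => concatFeature (fun m : Fin M => R m ω) X (X i) ⬝ᵥ
          concatFeature (fun m : Fin M => R m ω) X (X j)) atTop
        (𝓝 (laplaceKernel lam (X i : Fin D → ℝ) (X j)))) ∧
      (fun M : ℕ => √(variance (fun ω => concatFeature (fun m : Fin M => R m ω) X (X i) ⬝ᵥ
          concatFeature (fun m : Fin M => R m ω) X (X j)) P)) =O[atTop]
        fun M : ℕ => (M : ℝ) ^ (-(1 / 2) : ℝ)) := by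
  have hcell : ∀ R : Ω → Setoid S,
      {ω | cellOf (R ω) (X i) = cellOf (R ω) (X j)} = {ω | R ω (X i) (X j)} := fun R =>
    Set.ext fun ω => cellOf_eq_cellOf_iff
  have hdot : ∀ {M : ℕ} (r : Fin M → Setoid S),
      concatFeature r X (X i) ⬝ᵥ concatFeature r X (X j) =
        (1 / M : ℝ) * ∑ m, sameCell (X i) (X j) (r m) := fun r => by
    simp_rw [concatFeature_dotProduct_concatFeature, feature_dotProduct_feature]
  refine ⟨fun R hR => ⟨fun ω => ?_, ?_, ?_, ?_⟩, fun M R hM hR _ => ⟨fun ω => ?_, ?_, ?_⟩,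
    fun R hR hind => ?_⟩
  · rw [feature_dotProduct_feature, hcell, ← sameCell_comp_eq_indicator]
  · rw [hcell]
    exact (hR.nullMeasurableSet_and_measure _ _).2
  · rw [← (hR.nullMeasurableSet_and_measure (X i) (X j)).2]
    congr 1
    ext ω
    simp [feature_dotProduct_feature, sameCell]
  · simp_rw [feature_dotProduct_feature]
    exact hR.integral_sameCell _ _
  · exact concatFeature_dotProduct_concatFeature _ X _ _
  · simp_rw [hdot]
    exact (memLp_finsetSum _ fun m _ => (hR m).memLp_sameCell (X i) (X j)).const_mul _
  · simp_rw [hdot]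
    rw [integral_const_mul, integral_finsetSum _ fun m _ =>
      ((hR m).memLp_sameCell (X i) (X j)).integrable one_le_two]
    simp only [fun m => (hR m).integral_sameCell (X i) (X j), Finset.sum_const, Finset.card_univ,
      Fintype.card_fin, nsmul_eq_mul]
    field_simp
  · have hindep : Pairwise fun m n => (fun ω => sameCell (X i) (X j) (R m ω)) ⟂ᵢ[P]
        fun ω => sameCell (X i) (X j) (R n ω) := fun m n hmn =>
      (hind.indepFun hmn).comp (measurable_sameCell _ _) (measurable_sameCell _ _)
    have hident := fun m => (hR m).identDistrib_sameCell (hR 0) (X i) (X j)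
    have hL2 := fun m => (hR m).memLp_sameCell (X i) (X j)
    simp_rw [hdot]
    refine ⟨?_, isBigO_sqrt_variance_average (Y := fun m ω => sameCell (X i) (X j) (R m ω))
      hL2 hindep hident⟩
    have hlln := strong_law_ae_real (fun m ω => sameCell (X i) (X j) (R m ω))
      ((hL2 0).integrable one_le_two) hindep hident
    rw [(hR 0).integral_sameCell] at hlln
    filter_upwards [hlln] with ω hω
    refine hω.congr fun M => ?_
    rw [Finset.sum_range, one_div, inv_mul_eq_div]
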